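/- Let $\mathbb R^m,\mathbb R^n$ carry the Euclidean norms and dot products, and $\mathbb R^m\times\mathbb R^n$ the norm $\|(x,y)\|=\|x\|+\|y\|$ and the dot product $\langle (u,v),(x,y)\rangle=\langle u,x\rangle+\langle v,y\rangle$. For a set $\Omega\subseteq\mathbb R^m\times\mathbb R^n$ and $a\in\Omega$, let $\widehat N(a;\Omega)$ be the set of all $w$ such that for every $\varepsilon>0$ there is $\delta>0$ with $\langle w,p-a\rangle\le\varepsilon\|p-a\|$ for all $p\in\Omega$ with $\|p-a\|<\delta$, and let $N(a;\Omega)$ be the set of all limits $w=\lim_k w_k$ with $w_k\in\widehat N(a_k;\Omega)$, $a_k\in\Omega$, $a_k\to a$. For a set-valued mapping $G:\mathbb R^m\rightrightarrows\mathbb R^n$ with graph $\operatorname{gph}G=\{(x,y): y\in G(x)\}$ and $(\bar x,\bar y)\in\operatorname{gph}G$, put $$D^*G(\bar x,\bar y)(v)=\{u\in\mathbb R^m : (u,-v)\in N((\bar x,\bar y);\operatorname{gph}G)\},\qquad v\in\mathbb R^n.$$ For $F\subseteq\mathbb R^n$ put $F^-=\{v\in\mathbb R^n:\langle v,f\rangle\le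 0\text{ for all }f\in F\}$ and $$T^F_G(x;y)=\inf\{t\ge 0:(y+tF)\cap G(x)\ne\emptyset\}\in[0,\infty],\qquad \inf\emptyset=\infty.$$ **Theorem.** Let $G:\mathbb R^m\rightrightarrows\mathbb R^n$ have closed graph, let $(\bar x,\bar y)\in\operatorname{gph}G$, and let $F\subseteq\mathbb R^n$ be nonempty, compact and convex. If $$\text{for all }u\in\mathbb R^m,\ v\in\mathbb R^n:\quad u\in D^*G(\bar x,\bar y)(v)\ \text{ and }\ v\in F^-\ \Longrightarrow\ u=0\text{ and }v=0, \tag{1}$$ then $T^F_G$ is Lipschitz continuous around $(\bar x,\bar y)$, that is, there are a constant $\ell\ge 0$ and a neighbourhood $V$ of $(\bar x,\bar y)$ such that $T^F_G$ is finite on $V$ and $$|T^F_G(x;y)-T^F_G(x';y')|\le \ell\,(\|x-x'\|+\|y-y'\|)\quad\text{for all }(x,y),(x',y')\in V.$$ Conversely, if $0\in F$ and $T^F_G$ is Lipschitz continuous around $(\bar x,\bar y)$, then (1) holds. -/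

import Mathlib

open scoped Topology Pointwise

noncomputable section

/-- The Euclidean space `ℝⁿ`. -/
abbrev Euc (n : ℕ) : Type := EuclideanSpace ℝ (Fin n)

/-- The dot product of `ℝᵐ × ℝⁿ`. -/
def pairDot {m n : ℕ} (p q : Euc m × Euc n) : ℝ :=
  inner ℝ p.1 q.1 + inner ℝ p.2 q.2

/-- The "sum" norm of `ℝᵐ × ℝⁿ`. -/
def sumNorm {m n : ℕ} (p : Euc m × Euc n) : ℝ :=
  ‖p.1‖ + ‖p.2‖

/-- The graph of a set-valued mapping `G : ℝᵐ ⇉ ℝⁿ`. -/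
def svGraph {m n : ℕ} (G : Euc m → Set (Euc n)) : Set (Euc m × Euc n) :=
  {p | p.2 ∈ G p.1}

/-- The Fréchet normal cone to `Ω ⊆ ℝᵐ × ℝⁿ` at `a ∈ Ω`: all `w` with
`⟨w, p - a⟩ ≤ o(‖p - a‖)` for `p ∈ Ω` (it is empty if `a ∉ Ω`). -/
def frechetNormalCone {m n : ℕ} (Ω : Set (Euc m × Euc n)) (a : Euc m × Euc n) :
    Set (Euc m × Euc n) :=
  {w | a ∈ Ω ∧ ∀ ε : ℝ, 0 < ε → ∃ δ : ℝ, 0 < δ ∧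
    ∀ p ∈ Ω, sumNorm (p - a) < δ → pairDot w (p - a) ≤ ε * sumNorm (p - a)}

/-- The Mordukhovich (limiting) normal cone to `Ω ⊆ ℝᵐ × ℝⁿ` at `a`. -/
def limitingNormalCone {m n : ℕ} (Ω : Set (Euc m × Euc n)) (a : Euc m × Euc n) :
    Set (Euc m × Euc n) :=
  {w | ∃ (p z : ℕ → Euc m × Euc n),
    (∀ k, p k ∈ Ω) ∧ Filter.Tendsto p Filter.atTop (𝓝 a) ∧
    (∀ k, z k ∈ frechetNormalCone Ω (p k)) ∧ Filter.Tendsto z Filter.atTop (𝓝 w)}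

/-- The Mordukhovich (limiting) coderivative `D*G(x, y) : ℝⁿ ⇉ ℝᵐ`. -/
def coderivative {m n : ℕ} (G : Euc m → Set (Euc n)) (x : Euc m) (y : Euc n) (v : Euc n) :
    Set (Euc m) :=
  {u | (u, -v) ∈ limitingNormalCone (svGraph G) (x, y)}

/-- `F⁺ = {v | ⟨v, x⟩ ≥ 0 for all x ∈ F}`. -/
def plusCone {n : ℕ} (F : Set (Euc n)) : Set (Euc n) :=
  {v | ∀ x ∈ F, 0 ≤ inner ℝ v x}

/-- `F⁻ = -F⁺`. -/
def minusCone {n : ℕ} (F : Set (Euc n)) : Set (Euc n) :=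
  -plusCone F

/-- The minimal time function `inf {t ≥ 0 | (y + tF) ∩ G(x) ≠ ∅}`, with values in `[0, ∞]`
(the infimum of the empty set is `∞`). -/
def minimalTime {m n : ℕ} (F : Set (Euc n)) (G : Euc m → Set (Euc n)) (x : Euc m) (y : Euc n) :
    EReal :=
  sInf ((fun t : ℝ => (t : EReal)) '' {t : ℝ | 0 ≤ t ∧ (({y} + t • F) ∩ G x).Nonempty})

/-- An extended-real-valued function on `ℝᵐ × ℝⁿ` is Lipschitz continuous around `a`: on some
neighbourhood of `a` it is finite and Lipschitz with respect to the sum norm. -/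
def LipschitzAround {m n : ℕ} (ψ : Euc m × Euc n → EReal) (a : Euc m × Euc n) : Prop :=
  ∃ ℓ : ℝ, 0 ≤ ℓ ∧ ∃ V ∈ 𝓝 a,
    (∀ p ∈ V, ψ p ≠ ⊤ ∧ ψ p ≠ ⊥) ∧
    ∀ p ∈ V, ∀ q ∈ V, |(ψ p).toReal - (ψ q).toReal| ≤ ℓ * sumNorm (p - q)

end

/-!
The condition on the coderivative says that no nonzero limiting normal `w` to the graph `Ω` of `G`
at `a = (x₀, y₀)` has `⟪w.2, f⟫ ≥ 0` for all `f ∈ F`. The link with the Lipschitz property is a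
local error bound: points `q` near `a` can be moved into `Ω` along `{0} × F` in time `O(dist(q,
Ω))`.

The error bound follows from the condition by a penalisation argument. Minimising `‖p - (0, s • f) -
q‖ + κ² / r * ‖p - p₀‖² + κ² * s` over `p ∈ Ω`, `s ≥ 0`, `f ∈ F`, where `p₀ ∈ Ω` and `r = ‖p₀ - q‖`,
either moves `q` into `Ω` in time at most `r / κ²`, or gives, as optimality conditions, a proximal
normal `-w - e` to `Ω` near `p₀` with `‖w‖ = 1`, `‖e‖ ≤ 2 * κ` and `⟪w.2, f⟫ ≤ κ²` on `F`
(`exists_add_smul_mem_or_exists_proximal_normal`). If the second case occurred for a sequence `κ →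
0` and points `p₀`, `q` approaching `a` at the rate `κ²`, a subsequence would converge to a
forbidden limiting normal. The penalty is quadratic in `p`, so that Fréchet normals appear at the
minimiser itself and no fuzzy sum rule is needed; the argument runs in an inner product space and is
transferred to `ℝᵐ × ℝⁿ` through `WithLp 2`.

The error bound gives the Lipschitz estimate because, `F` being convex, consecutive motions along `t
• F` and `s • F` make up a motion along `(t + s) • F` (`lipschitzAround_minimalTime`).

Conversely, the minimal time vanishes on `Ω`, so a Lipschitz minimal time function lets every point
near `p ∈ Ω` reach `Ω` in time proportional to its distance from `p`. Testing a Fréchet normal `w`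
at `p` against the points reached from `p + τ • w` bounds `‖w‖²` by a multiple of the amount by
which `w` fails to be nonnegative on `F` (`pairDot_self_le_of_mem_frechetNormalCone`), and this
amount tends to zero along a sequence defining a limiting normal that is nonnegative on `F`.
-/

/-! ### Proximal normals from penalised minimisation -/

section InnerProductSpace

variable {E : Type*} [NormedAddCommGroup E] [InnerProductSpace ℝ E]

theorem norm_add_le_norm_add_inner_div {x : E} (hx : x ≠ 0) (d : E) :
    ‖x + d‖ ≤ ‖x‖ + inner ℝ x d / ‖x‖ + ‖d‖ ^ 2 / (2 * ‖x‖) := by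
  have hpos : 0 < ‖x‖ := norm_pos_iff.2 hx
  have hsq := norm_add_sq_real x d
  have hamgm : 2 * ‖x‖ * ‖x + d‖ ≤ ‖x‖ ^ 2 + ‖x + d‖ ^ 2 := two_mul_le_add_sq _ _
  have heq : ‖x‖ + inner ℝ x d / ‖x‖ + ‖d‖ ^ 2 / (2 * ‖x‖)
      = (‖x‖ ^ 2 + ‖x + d‖ ^ 2) / (2 * ‖x‖) := by
    rw [hsq]; field_simp; ring
  rw [heq, le_div_iff₀ (by positivity)]
  linarith

theorem Convex.exists_mem_smul_add {V : Type*} [AddCommGroup V] [Module ℝ V] {K : Set V}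
    (hK : Convex ℝ K) {f g : V} (hf : f ∈ K) (hg : g ∈ K) {s t : ℝ} (hs : 0 ≤ s) (ht : 0 ≤ t) :
    ∃ h ∈ K, (s + t) • h = s • f + t • g := by
  have hmem : s • f + t • g ∈ (s + t) • K := by
    rw [hK.add_smul hs ht]
    exact Set.add_mem_add (Set.smul_mem_smul_set hf) (Set.smul_mem_smul_set hg)
  obtain ⟨h, hh, he⟩ := hmem
  exact ⟨h, hh, he⟩

/-- Let `r = ‖p₀ - q‖`. If the penalised distance `‖p - s • f - q‖ + κ² / r * ‖p - p₀‖² + κ² * s`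
is minimised over `p ∈ Ω`, `s ≥ 0`, `f ∈ K`, either the distance vanishes at a minimiser, so that
`q` can be moved into `Ω` along `s • K` with `s ≤ r / κ²`, or the optimality conditions there
produce, for small `κ`, a proximal normal `-w - e` of norm close to one that is almost nonnegative
on `K`. -/
theorem exists_add_smul_mem_or_exists_proximal_normal [ProperSpace E] {Ω K : Set E}
    (hΩ : IsClosed Ω) (hKne : K.Nonempty) (hK : IsCompact K) (hKc : Convex ℝ K)
    {κ : ℝ} (hκ : 0 < κ) {p₀ q : E} (hp₀ : p₀ ∈ Ω) (hq : p₀ ≠ q) :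
    (∃ s : ℝ, 0 ≤ s ∧ s ≤ ‖p₀ - q‖ / κ ^ 2 ∧ ∃ f ∈ K, q + s • f ∈ Ω) ∨
    ∃ p ∈ Ω, ‖p - p₀‖ ≤ ‖p₀ - q‖ / κ ∧ ∃ w e : E, ‖w‖ = 1 ∧ ‖e‖ ≤ 2 * κ ∧
      (∃ M : ℝ, ∀ p' ∈ Ω, inner ℝ (-w - e) (p' - p) ≤ M * ‖p' - p‖ ^ 2) ∧
      ∀ f ∈ K, inner ℝ w f ≤ κ ^ 2 := by
  obtain ⟨f₀, hf₀⟩ := hKne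
  set r := ‖p₀ - q‖ with hr
  have hrpos : 0 < r := norm_pos_iff.2 (sub_ne_zero.2 hq)
  let h : E × ℝ × E → ℝ := fun z =>
    ‖z.1 - z.2.1 • z.2.2 - q‖ + κ ^ 2 / r * ‖z.1 - p₀‖ ^ 2 + κ ^ 2 * z.2.1
  have hcont : Continuous h := by fun_prop
  let C : Set (E × ℝ × E) :=
    (Ω ∩ Metric.closedBall p₀ (r / κ)) ×ˢ (Set.Icc 0 (r / κ ^ 2) ×ˢ K)
  have hC : IsCompact C :=
    ((isCompact_closedBall p₀ _).inter_left hΩ).prod (isCompact_Icc.prod hK)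
  have hstart : (p₀, (0 : ℝ), f₀) ∈ C :=
    ⟨⟨hp₀, Metric.mem_closedBall_self (by positivity)⟩, ⟨le_rfl, by positivity⟩, hf₀⟩
  obtain ⟨⟨p, s, f⟩, ⟨⟨hpΩ, hpb⟩, ⟨hs0, hs1⟩, hf⟩, hmin⟩ :=
    hC.exists_isMinOn ⟨_, hstart⟩ hcont.continuousOn
  have hhstart : h (p₀, 0, f₀) = r := by simp [h, hr]
  have hle : h (p, s, f) ≤ r := hhstart ▸ hmin hstart
  -- Outside of `C` one of the two penalties alone exceeds the starting value `r`.
  have hglob : ∀ p' ∈ Ω, ∀ s' : ℝ, 0 ≤ s' → ∀ f' ∈ K, h (p, s, f) ≤ h (p', s', f') := by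
    intro p' hp' s' hs' f' hf'
    by_cases hmem : (p', s', f') ∈ C
    · exact hmin hmem
    · refine hle.trans ?_
      have h1 : 0 ≤ ‖p' - s' • f' - q‖ := norm_nonneg _
      have h2 : 0 ≤ κ ^ 2 / r * ‖p' - p₀‖ ^ 2 := by positivity
      have h3 : 0 ≤ κ ^ 2 * s' := by positivity
      change r ≤ ‖p' - s' • f' - q‖ + κ ^ 2 / r * ‖p' - p₀‖ ^ 2 + κ ^ 2 * s'
      by_cases hb : ‖p' - p₀‖ ≤ r / κ
      · have hs'' : r / κ ^ 2 < s' := by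
          by_contra! hcon
          exact hmem ⟨⟨hp', by rwa [mem_closedBall_iff_norm]⟩, ⟨hs', hcon⟩, hf'⟩
        rw [div_lt_iff₀ (by positivity)] at hs''
        linarith
      · push Not at hb
        have h4 : (r / κ) ^ 2 ≤ ‖p' - p₀‖ ^ 2 := by gcongr
        have h5 : κ ^ 2 / r * (r / κ) ^ 2 = r := by field_simp
        have h6 : κ ^ 2 / r * (r / κ) ^ 2 ≤ κ ^ 2 / r * ‖p' - p₀‖ ^ 2 := by gcongr
        linarith
  rw [mem_closedBall_iff_norm] at hpb
  set Ψ := p - s • f - q with hΨ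
  by_cases hΨ0 : Ψ = 0
  · left
    refine ⟨s, hs0, hs1, f, hf, ?_⟩
    have : q + s • f = p := by
      have := hΨ ▸ hΨ0
      rw [sub_sub, sub_eq_zero] at this
      rw [this, add_comm]
    rwa [this]
  right
  have hΨpos : 0 < ‖Ψ‖ := norm_pos_iff.2 hΨ0
  refine ⟨p, hpΩ, hpb, ‖Ψ‖⁻¹ • Ψ, (2 * (κ ^ 2 / r)) • (p - p₀), ?_, ?_, ?_, ?_⟩
  · rw [norm_smul, norm_inv, norm_norm, inv_mul_cancel₀ hΨpos.ne']
  · rw [norm_smul, Real.norm_of_nonneg (by positivity)]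
    calc 2 * (κ ^ 2 / r) * ‖p - p₀‖ ≤ 2 * (κ ^ 2 / r) * (r / κ) := by gcongr
      _ = 2 * κ := by field_simp
  · refine ⟨1 / (2 * ‖Ψ‖) + κ ^ 2 / r, fun p' hp' => ?_⟩
    have h1 : ‖Ψ‖ + κ ^ 2 / r * ‖p - p₀‖ ^ 2 + κ ^ 2 * s
        ≤ ‖p' - s • f - q‖ + κ ^ 2 / r * ‖p' - p₀‖ ^ 2 + κ ^ 2 * s :=
      hglob p' hp' s hs0 f hf
    have h2 : p' - s • f - q = Ψ + (p' - p) := by rw [hΨ]; abel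
    have h3 : p' - p₀ = (p - p₀) + (p' - p) := by abel
    have h4 := norm_add_le_norm_add_inner_div hΨ0 (p' - p)
    rw [h2, h3, norm_add_sq_real] at h1
    rw [inner_sub_left, inner_neg_left, real_inner_smul_left, real_inner_smul_left]
    have h5 : inner ℝ Ψ (p' - p) / ‖Ψ‖ = ‖Ψ‖⁻¹ * inner ℝ Ψ (p' - p) := by ring
    have h6 : ‖p' - p‖ ^ 2 / (2 * ‖Ψ‖) = 1 / (2 * ‖Ψ‖) * ‖p' - p‖ ^ 2 := by ring
    rw [h5, h6] at h4
    linarith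
  · intro g hg
    rw [real_inner_smul_left]
    have hτ : ∀ τ : ℝ, 0 < τ →
        ‖Ψ‖⁻¹ * inner ℝ Ψ g ≤ κ ^ 2 + τ * (‖g‖ ^ 2 / (2 * ‖Ψ‖)) := by
      intro τ hτ
      obtain ⟨k, hk, hke⟩ := hKc.exists_mem_smul_add hf hg hs0 hτ.le
      have h1 : ‖Ψ‖ + κ ^ 2 / r * ‖p - p₀‖ ^ 2 + κ ^ 2 * s
          ≤ ‖p - (s + τ) • k - q‖ + κ ^ 2 / r * ‖p - p₀‖ ^ 2 + κ ^ 2 * (s + τ) :=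
        hglob p hpΩ (s + τ) (by positivity) k hk
      have h2 : p - (s + τ) • k - q = Ψ + (-τ) • g := by
        rw [hke, hΨ, neg_smul]; abel
      have h4 := norm_add_le_norm_add_inner_div hΨ0 ((-τ) • g)
      rw [h2] at h1
      rw [real_inner_smul_right, norm_smul, norm_neg, Real.norm_of_nonneg hτ.le] at h4
      have h5 : τ * (‖Ψ‖⁻¹ * inner ℝ Ψ g) ≤ τ * (κ ^ 2 + τ * (‖g‖ ^ 2 / (2 * ‖Ψ‖))) := by
        have h6 : -τ * inner ℝ Ψ g / ‖Ψ‖ = - (τ * (‖Ψ‖⁻¹ * inner ℝ Ψ g)) := by ring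
        have h7 : (τ * ‖g‖) ^ 2 / (2 * ‖Ψ‖) = τ * (τ * (‖g‖ ^ 2 / (2 * ‖Ψ‖))) := by ring
        rw [h6, h7] at h4
        linarith
      exact le_of_mul_le_mul_left h5 hτ
    have hlim : Filter.Tendsto (fun τ : ℝ => κ ^ 2 + τ * (‖g‖ ^ 2 / (2 * ‖Ψ‖)))
        (𝓝[>] 0) (𝓝 (κ ^ 2)) := by
      have : Continuous fun τ : ℝ => κ ^ 2 + τ * (‖g‖ ^ 2 / (2 * ‖Ψ‖)) := by fun_prop
      simpa using (this.tendsto 0).mono_left nhdsWithin_le_nhds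
    exact ge_of_tendsto hlim (eventually_mem_nhdsWithin.mono fun τ h => hτ τ h)

/-- Either the time needed to move a point `q` into `Ω` along `K` is bounded, near `a`, by a
multiple of the distance from `q` to `Ω`, or there is a nonzero limit `-w` of proximal normals to
`Ω` at points tending to `a` such that `w` is nonpositive on `K`. -/
theorem exists_error_bound_or_exists_limiting_normal [FiniteDimensional ℝ E] {Ω K : Set E}
    (hΩ : IsClosed Ω) (hKne : K.Nonempty) (hK : IsCompact K) (hKc : Convex ℝ K) (a : E) :
    (∃ C : ℝ, 0 ≤ C ∧ ∃ δ : ℝ, 0 < δ ∧ ∀ p ∈ Ω, ∀ q, ‖p - a‖ < δ → ‖q - a‖ < δ →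
      ∃ s : ℝ, 0 ≤ s ∧ s ≤ C * ‖p - q‖ ∧ ∃ f ∈ K, q + s • f ∈ Ω) ∨
    ∃ w : E, w ≠ 0 ∧ (∀ f ∈ K, inner ℝ w f ≤ 0) ∧ ∃ p z : ℕ → E, (∀ k, p k ∈ Ω) ∧
      Filter.Tendsto p Filter.atTop (𝓝 a) ∧
      (∀ k, ∃ M : ℝ, ∀ p' ∈ Ω, inner ℝ (z k) (p' - p k) ≤ M * ‖p' - p k‖ ^ 2) ∧
      Filter.Tendsto z Filter.atTop (𝓝 (-w)) := by
  have : ProperSpace E := FiniteDimensional.proper_real E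
  by_cases herr : ∃ C : ℝ, 0 ≤ C ∧ ∃ δ : ℝ, 0 < δ ∧ ∀ p ∈ Ω, ∀ q, ‖p - a‖ < δ → ‖q - a‖ < δ →
      ∃ s : ℝ, 0 ≤ s ∧ s ≤ C * ‖p - q‖ ∧ ∃ f ∈ K, q + s • f ∈ Ω
  · exact Or.inl herr
  right
  have hstep : ∀ κ : ℝ, 0 < κ → ∃ p ∈ Ω, ‖p - a‖ ≤ κ ^ 2 + 2 * κ ∧ ∃ w e : E, ‖w‖ = 1 ∧
      ‖e‖ ≤ 2 * κ ∧ (∃ M : ℝ, ∀ p' ∈ Ω, inner ℝ (-w - e) (p' - p) ≤ M * ‖p' - p‖ ^ 2) ∧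
      ∀ f ∈ K, inner ℝ w f ≤ κ ^ 2 := by
    intro κ hκ
    by_contra hcon
    refine herr ⟨1 / κ ^ 2, by positivity, κ ^ 2, by positivity, fun p hp q hpa hqa => ?_⟩
    rcases eq_or_ne p q with rfl | hpq
    · obtain ⟨f, hf⟩ := hKne
      exact ⟨0, le_rfl, by positivity, f, hf, by simpa using hp⟩
    rcases exists_add_smul_mem_or_exists_proximal_normal hΩ hKne hK hKc hκ hp hpq with
      ⟨s, hs, hs', h⟩ | ⟨p', hp', hd, h⟩
    · exact ⟨s, hs, by rwa [one_div_mul_eq_div], h⟩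
    · refine absurd ⟨p', hp', ?_, h⟩ hcon
      have h1 : ‖p - q‖ ≤ 2 * κ ^ 2 := by
        have := norm_sub_le (p - a) (q - a)
        rw [sub_sub_sub_cancel_right] at this
        linarith
      have h2 : ‖p - q‖ / κ ≤ 2 * κ := by
        rw [div_le_iff₀ hκ]; linarith [sq κ]
      have h3 : ‖p' - a‖ ≤ ‖p' - p‖ + ‖p - a‖ := norm_sub_le_norm_sub_add_norm_sub _ _ _
      linarith
  have hκpos : ∀ k : ℕ, (0 : ℝ) < 1 / ((k : ℝ) + 1) := fun k => by positivity
  choose p hpΩ hpa w e hw he hM hf using fun k : ℕ => hstep (1 / ((k : ℝ) + 1)) (hκpos k)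
  have hκlim : Filter.Tendsto (fun k : ℕ => 1 / ((k : ℝ) + 1)) Filter.atTop (𝓝 0) :=
    tendsto_one_div_add_atTop_nhds_zero_nat
  obtain ⟨w₀, hw₀, φ, hφ, hlim⟩ :=
    (isCompact_sphere (0 : E) 1).tendsto_subseq (x := w) fun k => by simp [hw k]
  have hφκ := hκlim.comp hφ.tendsto_atTop
  refine ⟨w₀, ?_, ?_, p ∘ φ, fun k => -w (φ k) - e (φ k), fun k => hpΩ _, ?_, fun k => hM _, ?_⟩
  · rintro rfl
    simp at hw₀
  · intro f hfK
    have h1 : Filter.Tendsto (fun k => inner ℝ (w (φ k)) f) Filter.atTop (𝓝 (inner ℝ w₀ f)) :=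
      hlim.inner tendsto_const_nhds
    have h2 := hφκ.pow 2
    rw [zero_pow two_ne_zero] at h2
    exact le_of_tendsto_of_tendsto' h1 h2 fun k => hf (φ k) f hfK
  · rw [tendsto_iff_norm_sub_tendsto_zero]
    have h2 := (hφκ.pow 2).add (hφκ.const_mul 2)
    simp only [mul_zero, zero_pow two_ne_zero, add_zero] at h2
    exact squeeze_zero (fun _ => norm_nonneg _) (fun k => hpa (φ k)) h2
  · have h1 : Filter.Tendsto (fun k => e (φ k)) Filter.atTop (𝓝 0) := by
      rw [tendsto_zero_iff_norm_tendsto_zero]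
      have h2 := hφκ.const_mul 2
      rw [mul_zero] at h2
      exact squeeze_zero (fun _ => norm_nonneg _) (fun k => he (φ k)) h2
    simpa using hlim.neg.sub h1

end InnerProductSpace

/-! ### The error bound and normal vectors in the product space -/

section Product

variable {m n : ℕ}

theorem pairDot_eq_inner (p q : Euc m × Euc n) :
    pairDot p q = inner ℝ (WithLp.toLp 2 p) (WithLp.toLp 2 q) := by
  simp [pairDot, WithLp.prod_inner_apply]

theorem sumNorm_nonneg (p : Euc m × Euc n) : 0 ≤ sumNorm p := by
  unfold sumNorm; positivity

theorem sumNorm_smul (τ : ℝ) (p : Euc m × Euc n) : sumNorm (τ • p) = |τ| * sumNorm p := by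
  simp [sumNorm, norm_smul, mul_add]

theorem sumNorm_add_le (p q : Euc m × Euc n) : sumNorm (p + q) ≤ sumNorm p + sumNorm q := by
  have h1 := norm_add_le p.1 q.1
  have h2 := norm_add_le p.2 q.2
  simp only [sumNorm, Prod.fst_add, Prod.snd_add]
  linarith

theorem sumNorm_neg (p : Euc m × Euc n) : sumNorm (-p) = sumNorm p := by
  simp [sumNorm]

theorem continuous_sumNorm : Continuous (sumNorm : Euc m × Euc n → ℝ) := by
  unfold sumNorm; fun_prop

theorem norm_toLp_le_sumNorm (p : Euc m × Euc n) : ‖WithLp.toLp 2 p‖ ≤ sumNorm p := by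
  rw [WithLp.prod_norm_eq_of_L2]
  refine Real.sqrt_le_iff.2 ⟨sumNorm_nonneg p, ?_⟩
  have h : 0 ≤ ‖p.1‖ * ‖p.2‖ := by positivity
  change ‖p.1‖ ^ 2 + ‖p.2‖ ^ 2 ≤ (‖p.1‖ + ‖p.2‖) ^ 2
  linarith [add_sq ‖p.1‖ ‖p.2‖]

theorem sumNorm_sub_mem_nhds (a : Euc m × Euc n) {δ : ℝ} (hδ : 0 < δ) :
    {p | sumNorm (p - a) < δ} ∈ 𝓝 a := by
  have hc : Continuous fun p : Euc m × Euc n => sumNorm (p - a) :=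
    continuous_sumNorm.comp (continuous_id.sub continuous_const)
  exact hc.continuousAt.eventually_lt continuousAt_const (by simpa [sumNorm] using hδ)

theorem mem_frechetNormalCone_of_proximal {Ω : Set (Euc m × Euc n)} {a w : Euc m × Euc n}
    (ha : a ∈ Ω) {M : ℝ}
    (h : ∀ p ∈ Ω, pairDot w (p - a) ≤ M * ‖WithLp.toLp 2 (p - a)‖ ^ 2) :
    w ∈ frechetNormalCone Ω a := by
  refine ⟨ha, fun ε hε => ⟨ε / (|M| + 1), by positivity, fun p hp hd => (h p hp).trans ?_⟩⟩
  have h0 := sumNorm_nonneg (p - a)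
  rw [lt_div_iff₀ (by positivity)] at hd
  calc M * ‖WithLp.toLp 2 (p - a)‖ ^ 2 ≤ (|M| + 1) * sumNorm (p - a) ^ 2 := by
        have := le_abs_self M
        have := norm_toLp_le_sumNorm (p - a)
        gcongr
        linarith
    _ = sumNorm (p - a) * (|M| + 1) * sumNorm (p - a) := by ring
    _ ≤ ε * sumNorm (p - a) := by gcongr

/-- The coderivative condition yields a local error bound: the time needed to move a point `q`
near `a` into `Ω` along `{0} × F` is at most a multiple of the distance from `q` to `Ω`. -/
theorem exists_error_bound {Ω : Set (Euc m × Euc n)} (hΩ : IsClosed Ω) (a : Euc m × Euc n)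
    {F : Set (Euc n)} (hFne : F.Nonempty) (hF : IsCompact F) (hFc : Convex ℝ F)
    (hN : ∀ w ∈ limitingNormalCone Ω a, (∀ f ∈ F, 0 ≤ inner ℝ w.2 f) → w = 0) :
    ∃ C : ℝ, 0 ≤ C ∧ ∃ δ : ℝ, 0 < δ ∧ ∀ p ∈ Ω, ∀ q, sumNorm (p - a) < δ → sumNorm (q - a) < δ →
      ∃ s : ℝ, 0 ≤ s ∧ s ≤ C * sumNorm (p - q) ∧ ∃ f ∈ F, (q.1, q.2 + s • f) ∈ Ω := by
  let ι : Euc n → WithLp 2 (Euc m × Euc n) := fun f => WithLp.toLp 2 (0, f)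
  have hιc : Continuous ι := (WithLp.prod_continuous_toLp 2 _ _).comp (by fun_prop)
  have hιl : IsLinearMap ℝ ι :=
    ⟨fun x y => by simp [ι, ← WithLp.toLp_add], fun c x => by simp [ι, ← WithLp.toLp_smul]⟩
  have hΩ' : IsClosed (WithLp.ofLp ⁻¹' Ω : Set (WithLp 2 (Euc m × Euc n))) :=
    hΩ.preimage (WithLp.prod_continuous_ofLp 2 _ _)
  rcases exists_error_bound_or_exists_limiting_normal hΩ' (hFne.image ι) (hF.image hιc)
    (hFc.is_linear_image hιl) (WithLp.toLp 2 a) with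
    ⟨C, hC, δ, hδ, h⟩ | ⟨w, hw0, hwF, p, z, hp, hpa, hz, hzw⟩
  · refine ⟨C, hC, δ, hδ, fun p hp q hpa hqa => ?_⟩
    obtain ⟨s, hs0, hs, _, ⟨f, hf, rfl⟩, hmem⟩ := h (WithLp.toLp 2 p) hp (WithLp.toLp 2 q)
      ((norm_toLp_le_sumNorm (p - a)).trans_lt hpa) ((norm_toLp_le_sumNorm (q - a)).trans_lt hqa)
    refine ⟨s, hs0, hs.trans ?_, f, hf, ?_⟩
    · exact mul_le_mul_of_nonneg_left (norm_toLp_le_sumNorm (p - q)) hC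
    · have he : WithLp.ofLp (WithLp.toLp 2 q + s • ι f) = (q.1, q.2 + s • f) := by
        ext <;> simp [ι]
      rw [← he]
      exact hmem
  · refine absurd ?_ hw0
    have hofLp := WithLp.prod_continuous_ofLp 2 (Euc m) (Euc n)
    have hmem : WithLp.ofLp (-w) ∈ limitingNormalCone Ω a := by
      refine ⟨fun k => WithLp.ofLp (p k), fun k => WithLp.ofLp (z k), hp,
        (hofLp.tendsto _).comp hpa, fun k => ?_, (hofLp.tendsto _).comp hzw⟩
      obtain ⟨M, hM⟩ := hz k
      refine mem_frechetNormalCone_of_proximal (hp k) (M := M) fun p' hp' => ?_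
      rw [pairDot_eq_inner]
      exact hM (WithLp.toLp 2 p') hp'
    have h0 := hN _ hmem fun f hf => by
      have h1 := hwF (ι f) ⟨f, hf, rfl⟩
      rw [WithLp.prod_inner_apply] at h1
      simpa [ι] using h1
    rw [WithLp.ofLp_neg, neg_eq_zero] at h0
    exact (WithLp.ofLp_eq_zero 2).1 h0

/-- A Fréchet normal `w` to `Ω` at `a` is small if it is almost nonnegative on `{0} × F` and points
`p` near `a` can be moved into `Ω` along `{0} × F` in time of order `p - a`: the normal inequality
is tested at the points of `Ω` reached from `a + τ • w`. -/
theorem pairDot_self_le_of_mem_frechetNormalCone {Ω : Set (Euc m × Euc n)} {a w : Euc m × Euc n}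
    {F : Set (Euc n)} {R ℓ σ : ℝ} (hR : 0 ≤ R) (hFR : ∀ f ∈ F, ‖f‖ ≤ R) (hℓ : 0 ≤ ℓ) (hσ : 0 ≤ σ)
    (hreach : ∀ᶠ p in 𝓝 a, ∀ c, ℓ * sumNorm (p - a) < c →
      ∃ t : ℝ, 0 ≤ t ∧ t < c ∧ ∃ f ∈ F, (p.1, p.2 + t • f) ∈ Ω)
    (hw : w ∈ frechetNormalCone Ω a) (hwF : ∀ f ∈ F, -σ ≤ inner ℝ w.2 f) :
    pairDot w w ≤ (ℓ * sumNorm w + 1) * σ := by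
  set S := sumNorm w with hS
  have hS0 : 0 ≤ S := sumNorm_nonneg w
  set B := S + (ℓ * S + 1) * R with hB
  have hB0 : 0 ≤ B := by positivity
  have key : ∀ ε : ℝ, 0 < ε → pairDot w w ≤ (ℓ * S + 1) * σ + ε * B := by
    intro ε hε
    obtain ⟨δ, hδ, hN⟩ := hw.2 ε hε
    have hline : Filter.Tendsto (fun τ : ℝ => a + τ • w) (𝓝[>] 0) (𝓝 a) := by
      have : Continuous fun τ : ℝ => a + τ • w := by fun_prop
      simpa using (this.tendsto 0).mono_left nhdsWithin_le_nhds
    have hsmall : ∀ᶠ τ : ℝ in 𝓝[>] 0, τ * B < δ := by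
      have hc : Continuous fun τ : ℝ => τ * B := by fun_prop
      have h1 : Filter.Tendsto (fun τ : ℝ => τ * B) (𝓝[>] 0) (𝓝 0) := by
        simpa using (hc.tendsto 0).mono_left nhdsWithin_le_nhds
      exact h1.eventually_lt_const hδ
    obtain ⟨τ, hτ, hτδ, hτpos⟩ :=
      ((hline.eventually hreach).and (hsmall.and self_mem_nhdsWithin)).exists
    have hdist : sumNorm (a + τ • w - a) = τ * S := by
      rw [add_sub_cancel_left, sumNorm_smul, abs_of_pos hτpos]
    obtain ⟨t, ht0, ht, f, hf, hmem⟩ := hτ (τ * (ℓ * S + 1)) (by rw [hdist]; linarith)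
    set d : Euc m × Euc n := τ • w + (0, t • f) with hd
    have hda : ((a + τ • w).1, (a + τ • w).2 + t • f) - a = d := by
      ext <;> simp [hd, add_assoc]
    have hdn : sumNorm d ≤ τ * B := by
      have h1 := sumNorm_add_le (τ • w) ((0 : Euc m), t • f)
      have h2 : sumNorm ((0 : Euc m), t • f) ≤ τ * (ℓ * S + 1) * R := by
        simp only [sumNorm, norm_zero, zero_add, norm_smul, Real.norm_of_nonneg ht0]
        exact mul_le_mul ht.le (hFR f hf) (norm_nonneg _) (by positivity)
      rw [sumNorm_smul, abs_of_pos hτpos] at h1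
      rw [hB]
      linarith
    have h1 := hN _ hmem (by rw [hda]; exact hdn.trans_lt hτδ)
    rw [hda] at h1
    have h2 : pairDot w d = τ * pairDot w w + t * inner ℝ w.2 f := by
      simp only [pairDot, hd, Prod.fst_add, Prod.snd_add, Prod.smul_fst, Prod.smul_snd,
        inner_add_right, real_inner_smul_right, inner_zero_right]
      ring
    have h3 : t * -σ ≤ t * inner ℝ w.2 f := mul_le_mul_of_nonneg_left (hwF f hf) ht0
    have h4 : t * σ ≤ τ * (ℓ * S + 1) * σ := mul_le_mul_of_nonneg_right ht.le hσ
    have h5 : ε * sumNorm d ≤ ε * (τ * B) := mul_le_mul_of_nonneg_left hdn hε.le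
    refine le_of_mul_le_mul_left ?_ hτpos
    rw [h2] at h1
    linarith
  refine le_of_forall_pos_le_add fun η hη => (key (η / (B + 1)) (by positivity)).trans ?_
  have : η / (B + 1) * B ≤ η := by
    rw [div_mul_eq_mul_div, div_le_iff₀ (by positivity)]
    linarith
  linarith

end Product

/-! ### The minimal time function -/

section MinimalTime

variable {m n : ℕ} {F : Set (Euc n)} {G : Euc m → Set (Euc n)}

theorem minimalTime_nonneg (F : Set (Euc n)) (G : Euc m → Set (Euc n)) (x : Euc m) (y : Euc n) :
    0 ≤ minimalTime F G x y := by
  refine le_sInf ?_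
  rintro _ ⟨t, ⟨ht, -⟩, rfl⟩
  exact EReal.coe_nonneg.2 ht

theorem minimalTime_le {x : Euc m} {y f : Euc n} {t : ℝ} (ht : 0 ≤ t) (hf : f ∈ F)
    (h : (x, y + t • f) ∈ svGraph G) : minimalTime F G x y ≤ t :=
  sInf_le ⟨t, ⟨ht, _, Set.add_mem_add rfl (Set.smul_mem_smul_set hf), h⟩, rfl⟩

theorem exists_of_minimalTime_lt {x : Euc m} {y : Euc n} {c : ℝ} (h : minimalTime F G x y < c) :
    ∃ t : ℝ, 0 ≤ t ∧ t < c ∧ ∃ f ∈ F, (x, y + t • f) ∈ svGraph G := by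
  obtain ⟨_, ⟨t, ⟨ht, z, hz, hzG⟩, rfl⟩, htc⟩ := sInf_lt_iff.1 h
  obtain ⟨y', rfl, _, ⟨f, hf, rfl⟩, rfl⟩ := hz
  exact ⟨t, ht, EReal.coe_lt_coe_iff.1 htc, f, hf, hzG⟩

theorem coe_toReal_minimalTime {x : Euc m} {y : Euc n} (h : minimalTime F G x y ≠ ⊤) :
    ((minimalTime F G x y).toReal : EReal) = minimalTime F G x y :=
  EReal.coe_toReal h (ne_bot_of_le_ne_bot EReal.zero_ne_bot (minimalTime_nonneg F G x y))

/-- A local error bound for the graph makes the minimal time function Lipschitz: if `y + t • f`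
lies in `G x`, then `(x', y' + t • f)` is as close to the graph as `(x', y')` is to `(x, y)`, and
by convexity the additional time to reach `G x'` just adds to `t`. -/
theorem lipschitzAround_minimalTime (hF : IsCompact F) (hFc : Convex ℝ F)
    {a : Euc m × Euc n} (ha : a ∈ svGraph G) {C δ : ℝ} (hC : 0 ≤ C) (hδ : 0 < δ)
    (h : ∀ p ∈ svGraph G, ∀ q, sumNorm (p - a) < δ → sumNorm (q - a) < δ →
      ∃ s : ℝ, 0 ≤ s ∧ s ≤ C * sumNorm (p - q) ∧ ∃ f ∈ F, (q.1, q.2 + s • f) ∈ svGraph G) :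
    LipschitzAround (fun p => minimalTime F G p.1 p.2) a := by
  obtain ⟨R, hR, hFR⟩ := hF.isBounded.exists_pos_norm_le
  -- For `q ∈ V` the minimal time is below `(C + 1) * ρ`, so `q + (0, t • f)` stays within `δ` of
  -- `a` for nearly optimal `t`.
  set ρ := δ / (1 + (C + 1) * R) with hρ
  have hρpos : 0 < ρ := by positivity
  have hρδ : ρ + (C + 1) * ρ * R = δ := by rw [hρ]; field_simp
  have hρle : ρ ≤ δ := by
    have : 0 ≤ (C + 1) * ρ * R := by positivity
    linarith
  have hbound : ∀ q : Euc m × Euc n, sumNorm (q - a) < ρ →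
      minimalTime F G q.1 q.2 < ((C + 1) * ρ : ℝ) := by
    intro q hq
    obtain ⟨s, hs0, hs, f, hf, hmem⟩ := h a ha q (by simpa [sumNorm] using hδ) (hq.trans_le hρle)
    refine (minimalTime_le hs0 hf hmem).trans_lt (EReal.coe_lt_coe_iff.2 (hs.trans_lt ?_))
    rw [← neg_sub, sumNorm_neg]
    have := mul_le_mul_of_nonneg_left hq.le hC
    linarith
  have hne : ∀ q : Euc m × Euc n, sumNorm (q - a) < ρ → minimalTime F G q.1 q.2 ≠ ⊤ :=
    fun q hq => (hbound q hq).ne_top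
  have hlip : ∀ q q' : Euc m × Euc n, sumNorm (q - a) < ρ → sumNorm (q' - a) < ρ →
      (minimalTime F G q'.1 q'.2).toReal
        ≤ (minimalTime F G q.1 q.2).toReal + C * sumNorm (q - q') := by
    intro q q' hq hq'
    rw [← sub_le_iff_le_add]
    refine le_of_forall_gt_imp_ge_of_dense fun c hc => ?_
    have hlt : minimalTime F G q.1 q.2 < ((min c ((C + 1) * ρ) : ℝ) : EReal) := by
      rw [EReal.coe_strictMono.monotone.map_min]
      refine lt_min ?_ (hbound q hq)
      rw [← coe_toReal_minimalTime (hne q hq)]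
      exact EReal.coe_lt_coe_iff.2 hc
    obtain ⟨t, ht0, ht, f, hf, hmem⟩ := exists_of_minimalTime_lt hlt
    have htf : ∀ p : Euc m × Euc n, sumNorm (p - a) < ρ →
        sumNorm ((p.1, p.2 + t • f) - a) < δ := by
      intro p hp
      have h1 := sumNorm_add_le (p - a) ((0 : Euc m), t • f)
      have h2 : sumNorm ((0 : Euc m), t • f) ≤ (C + 1) * ρ * R := by
        simp only [sumNorm, norm_zero, zero_add, norm_smul, Real.norm_of_nonneg ht0]
        exact mul_le_mul (ht.le.trans (min_le_right _ _)) (hFR f hf) (norm_nonneg _) (by positivity)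
      have h3 : (p.1, p.2 + t • f) - a = p - a + ((0 : Euc m), t • f) := by
        ext <;> simp [sub_add_eq_add_sub]
      rw [h3]
      linarith
    obtain ⟨s, hs0, hs, g, hg, hmem'⟩ := h _ hmem (q'.1, q'.2 + t • f) (htf q hq) (htf q' hq')
    obtain ⟨k, hk, hke⟩ := hFc.exists_mem_smul_add hf hg ht0 hs0
    have hT : minimalTime F G q'.1 q'.2 ≤ ((t + s : ℝ) : EReal) := by
      refine minimalTime_le (add_nonneg ht0 hs0) hk ?_
      rw [hke, ← add_assoc]
      exact hmem'
    rw [← coe_toReal_minimalTime (hne q' hq'), EReal.coe_le_coe_iff] at hT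
    have hd : (q.1, q.2 + t • f) - (q'.1, q'.2 + t • f) = q - q' := by
      ext <;> simp
    rw [hd] at hs
    have := ht.le.trans (min_le_left _ _)
    linarith
  refine ⟨C, hC, _, sumNorm_sub_mem_nhds a hρpos, fun p hp => ⟨hne p hp, ?_⟩, fun p hp q hq => ?_⟩
  · exact ne_bot_of_le_ne_bot EReal.zero_ne_bot (minimalTime_nonneg F G p.1 p.2)
  · rw [abs_sub_le_iff]
    have h1 := hlip p q hp hq
    have h2 := hlip q p hq hp
    rw [← neg_sub p q, sumNorm_neg] at h2
    constructor <;> linarith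

/-- If the minimal time function is Lipschitz around `a`, the limiting normals to the graph of `G`
at `a` that are nonnegative on `{0} × F` vanish. -/
theorem eq_zero_of_lipschitzAround_minimalTime (hFne : F.Nonempty) (hF : IsCompact F)
    {a w : Euc m × Euc n} (hL : LipschitzAround (fun p => minimalTime F G p.1 p.2) a)
    (hw : w ∈ limitingNormalCone (svGraph G) a) (hwF : ∀ f ∈ F, 0 ≤ inner ℝ w.2 f) : w = 0 := by
  obtain ⟨ℓ, hℓ, V, hV, hfin, hlip⟩ := hL
  obtain ⟨p, z, hp, hpa, hz, hzw⟩ := hw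
  obtain ⟨R, hR, hFR⟩ := hF.isBounded.exists_pos_norm_le
  have hzk : ∀ᶠ k in Filter.atTop,
      pairDot (z k) (z k) ≤ (ℓ * sumNorm (z k) + 1) * (‖(z k).2 - w.2‖ * R) := by
    filter_upwards [hpa.eventually (eventually_eventually_nhds.2 hV)] with k hk
    refine pairDot_self_le_of_mem_frechetNormalCone hR.le hFR hℓ (by positivity) ?_ (hz k) ?_
    · filter_upwards [hk] with q hq c hc
      have hpk : minimalTime F G (p k).1 (p k).2 = 0 := by
        obtain ⟨f, hf⟩ := hFne
        refine le_antisymm ?_ (minimalTime_nonneg F G _ _)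
        exact_mod_cast minimalTime_le (G := G) (x := (p k).1) (y := (p k).2) (t := 0) le_rfl hf
          (by simpa using hp k)
      have h1 := hlip q hq (p k) (mem_of_mem_nhds hk)
      simp only [hpk, EReal.toReal_zero, sub_zero] at h1
      refine exists_of_minimalTime_lt ?_
      rw [← coe_toReal_minimalTime (hfin q hq).1]
      exact EReal.coe_lt_coe_iff.2 (((le_abs_self _).trans h1).trans_lt hc)
    · intro f hf
      have h1 : -(‖(z k).2 - w.2‖ * ‖f‖) ≤ inner ℝ ((z k).2 - w.2) f :=
        (abs_le.1 (abs_real_inner_le_norm _ _)).1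
      have h2 : ‖(z k).2 - w.2‖ * ‖f‖ ≤ ‖(z k).2 - w.2‖ * R :=
        mul_le_mul_of_nonneg_left (hFR f hf) (norm_nonneg _)
      rw [inner_sub_left] at h1
      have h3 := hwF f hf
      linarith
  have hcl : Continuous fun v : Euc m × Euc n => pairDot v v := by
    unfold pairDot; fun_prop
  have hcr : Continuous fun v : Euc m × Euc n =>
      (ℓ * sumNorm v + 1) * (‖v.2 - w.2‖ * R) := by
    unfold sumNorm; fun_prop
  have hle := le_of_tendsto_of_tendsto ((hcl.tendsto w).comp hzw) ((hcr.tendsto w).comp hzw) hzk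
  simp only [sub_self, norm_zero, zero_mul, mul_zero, pairDot, real_inner_self_eq_norm_sq] at hle
  have h1 : ‖w.1‖ = 0 := by nlinarith [sq_nonneg ‖w.1‖, sq_nonneg ‖w.2‖]
  have h2 : ‖w.2‖ = 0 := by nlinarith [sq_nonneg ‖w.1‖, sq_nonneg ‖w.2‖]
  exact Prod.ext (norm_eq_zero.1 h1) (norm_eq_zero.1 h2)

end MinimalTime

theorem theorem3p4 {m n : ℕ} (G : Euc m → Set (Euc n)) (F : Set (Euc n))
    (x₀ : Euc m) (y₀ : Euc n)
    (hG : IsClosed (svGraph G)) (hxy : (x₀, y₀) ∈ svGraph G)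
    (hFne : F.Nonempty) (hFcpt : IsCompact F) (hFconv : Convex ℝ F) :
    ((∀ (u : Euc m) (v : Euc n),
        u ∈ coderivative G x₀ y₀ v → v ∈ minusCone F → u = 0 ∧ v = 0) →
      LipschitzAround (fun p => minimalTime F G p.1 p.2) (x₀, y₀)) ∧
    ((0 : Euc n) ∈ F →
      LipschitzAround (fun p => minimalTime F G p.1 p.2) (x₀, y₀) →
      ∀ (u : Euc m) (v : Euc n),
        u ∈ coderivative G x₀ y₀ v → v ∈ minusCone F → u = 0 ∧ v = 0) := by
  constructor
  · intro hcod
    obtain ⟨C, hC, δ, hδ, h⟩ := exists_error_bound hG (x₀, y₀) hFne hFcpt hFconv fun w hw hwF => by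
      obtain ⟨h1, h2⟩ := hcod w.1 (-w.2) (by simpa [coderivative] using hw)
        (by simpa [minusCone, plusCone] using hwF)
      exact Prod.ext h1 (neg_eq_zero.1 h2)
    exact lipschitzAround_minimalTime hFcpt hFconv hxy hC hδ h
  · intro _ hL u v hu hv
    have h0 := eq_zero_of_lipschitzAround_minimalTime hFne hFcpt hL hu fun f hf => hv f hf
    exact ⟨congrArg Prod.fst h0, neg_eq_zero.1 (congrArg Prod.snd h0)⟩
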